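/- Identify $\mathbb{R}^2$ with $\mathbb{C}$. A \emph{closed transversely intersected curve} is a closed curve $C$ in $\mathbb{R}^2$, given by a continuous map $\gamma\colon \mathbb{R}/\mathbb{Z}\to\mathbb{R}^2$, such that: only finitely many points of $\mathbb{R}^2$ have more than one preimage under $\gamma$ (the \emph{crossing points}), and each of these has exactly two; every $t\in\mathbb{R}/\mathbb{Z}$ has a neighbourhood whose image is carried into a straight line by some local homeomorphism of the plane; and at each crossing point the two branches intersect transversely, that is, some local homeomorphism of the plane carries one branch into the horizontal and the other into the vertical coordinate axis. (For instance, $C$ may be a $C^1$ immersed or a piecewise linear closed curve whose only multiple points are finitely many transverse double points.) An oriented curve is such a curve considered up to orientation-preserving homeomorphisms of $\mathbb{R}/\mathbb{Z}$, and $-C$ denotes $C$ with the opposite orientation. A \emph{based} curve $C_b$ is a curve $C$ together with a base point $b$ on $C$ that is not a crossing point. A homeomorphism of $\mathbb{R}^2$ is orientation-preserving if it has local degree $+1$ at every point, i.e. it sends every counterclockwise circle about a point $p$ to a closed curve of winding number $1$ about the image of $p$. (1) For every oriented closed transversely intersected curve $C$ on $\mathbb{R}^2$ with an even number of crossing points (possibly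 zero), there is no orientation-preserving homeomorphism $\mathbb{R}^2\to\mathbb{R}^2$ sending $C$ to $-C$. (2) For every based oriented closed transversely intersected curve $C_b$ on $\mathbb{R}^2$ with an odd number of crossing points, there is no orientation-preserving homeomorphism $h\colon\mathbb{R}^2\to\mathbb{R}^2$ with $h(b)=b$ sending $C$ to $-C$. -/

import Mathlib

/-- An oriented closed curve in the plane `ℝ² = ℂ`, given by a continuous `1`-periodic
parametrization (equivalently, a continuous map from the circle `ℝ / ℤ`). The orientation is
the direction of increasing parameter; see `ClosedCurve.SameOriented` for the equivalence of
parametrizations. -/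
structure ClosedCurve where
  toFun : ℝ → ℂ
  continuous_toFun : Continuous toFun
  periodic_toFun : Function.Periodic toFun 1

namespace ClosedCurve

/-- Two real parameters represent the same point of the circle `ℝ / ℤ`. -/
def SameParam (s t : ℝ) : Prop := ∃ n : ℤ, t = s + n

/-- The underlying point set of the curve. -/
def support (C : ClosedCurve) : Set ℂ := Set.range C.toFun

/-- The crossing points: the points of the plane through which the curve passes at two
different points of the circle. -/
def crossings (C : ClosedCurve) : Set ℂ :=
  {p | ∃ s t : ℝ, ¬ SameParam s t ∧ C.toFun s = p ∧ C.toFun t = p}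

/-- The number of crossing points (only used for curves with finitely many of them). -/
noncomputable def crossingNumber (C : ClosedCurve) : ℕ := C.crossings.ncard

/-- A closed transversely intersected curve: finitely many crossing points, all of them double
points, the curve is locally flat (up to a local homeomorphism of the plane, each branch runs in
the real axis), and at each crossing point the two branches intersect transversely (up to a local
homeomorphism of the plane, they run in the real axis and the imaginary axis, respectively).
This includes all `C¹` immersed and all piecewise linear closed curves whose only multiple points
are finitely many transverse double points. -/
structure IsGeneric (C : ClosedCurve) : Prop where
  finite_crossings : C.crossings.Finite
  double : ∀ s t u : ℝ, C.toFun s = C.toFun t → C.toFun t = C.toFun u →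
    SameParam s t ∨ SameParam t u ∨ SameParam s u
  locallyFlat : ∀ t : ℝ, ∃ e : OpenPartialHomeomorph ℂ ℂ, ∃ ε > 0,
    ∀ u : ℝ, |u - t| < ε → C.toFun u ∈ e.source ∧ (e (C.toFun u)).im = 0
  transverse : ∀ s t : ℝ, ¬ SameParam s t → C.toFun s = C.toFun t →
    ∃ e : OpenPartialHomeomorph ℂ ℂ, ∃ ε > 0,
      (∀ u : ℝ, |u - s| < ε → C.toFun u ∈ e.source ∧ (e (C.toFun u)).im = 0) ∧
      (∀ u : ℝ, |u - t| < ε → C.toFun u ∈ e.source ∧ (e (C.toFun u)).re = 0)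

/-- The curve `-C`: the same curve with the opposite orientation. -/
def reverse (C : ClosedCurve) : ClosedCurve where
  toFun t := C.toFun (-t)
  continuous_toFun := C.continuous_toFun.comp continuous_neg
  periodic_toFun t := by
    show C.toFun (-(t + 1)) = C.toFun (-t)
    rw [← C.periodic_toFun (-(t + 1))]
    congr 1
    ring

/-- The image of an oriented closed curve under a homeomorphism of the plane. -/
noncomputable def map (h : ℂ ≃ₜ ℂ) (C : ClosedCurve) : ClosedCurve where
  toFun t := h (C.toFun t)
  continuous_toFun := h.continuous.comp C.continuous_toFun
  periodic_toFun t := congrArg h (C.periodic_toFun t)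

/-- `C` and `D` are the same oriented closed curve: they differ by an orientation-preserving
homeomorphism of the circle `ℝ / ℤ`, i.e. by an increasing bijection `ρ` of `ℝ` that commutes
with the translation by `1`. -/
def SameOriented (C D : ClosedCurve) : Prop :=
  ∃ ρ : ℝ ≃o ℝ, (∀ t, ρ (t + 1) = ρ t + 1) ∧ ∀ t, C.toFun t = D.toFun (ρ t)

/-- The circle of centre `p` and radius `r`, oriented counterclockwise. -/
noncomputable def circle (p : ℂ) (r : ℝ) : ClosedCurve where
  toFun t := circleMap p r (2 * Real.pi * t)
  continuous_toFun := (continuous_circleMap p r).comp (by fun_prop)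
  periodic_toFun t := by
    show circleMap p r (2 * Real.pi * (t + 1)) = circleMap p r (2 * Real.pi * t)
    rw [mul_add, mul_one, periodic_circleMap p r]

/-- The closed curve `C` does not pass through `p` and its winding number about `p` is `n`:
there is a continuous branch `θ` of `log (C - p)` along `C`, and `θ` increases by `2πi n` in one
turn. -/
def HasWindingNumber (C : ClosedCurve) (p : ℂ) (n : ℤ) : Prop :=
  ∃ θ : ℝ → ℂ, Continuous θ ∧ (∀ t, C.toFun t = p + Complex.exp (θ t)) ∧
    ∀ t, θ (t + 1) = θ t + 2 * Real.pi * Complex.I * n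

end ClosedCurve

/-- A homeomorphism of the plane is orientation-preserving if it has local degree `1` at every
point `p`: it sends each counterclockwise circle about `p` to a closed curve of winding number `1`
about the image of `p`. -/
def OrientationPreserving (h : ℂ ≃ₜ ℂ) : Prop :=
  ∀ (p : ℂ) (r : ℝ), 0 < r → ((ClosedCurve.circle p r).map h).HasWindingNumber (h p) 1

/-- `h` sends the oriented closed curve `C` to the oriented closed curve `D`. -/
def SendsTo (h : ℂ ≃ₜ ℂ) (C D : ClosedCurve) : Prop := (C.map h).SameOriented D

open Filter Topology Set

/-! Suppose an orientation-preserving `h` sends `C` to `-C`. On parameters it acts by a decreasing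
`σ` with `σ (t + 1) = σ t - 1`, a reflection of the circle up to reparametrization, which has a
fixed point and at most two of them modulo 1.

A fixed parameter `t` cannot lie over a non-crossing point `b` (`not_fixed_of_notMem_crossings`).
Locally nothing forbids this, since a half turn reverses a line; the obstruction is global. Cut `C`
open at `b` and follow a continuous argument of `C - b`. Read in a flat chart, the two ends lie on
opposite rays, so their arguments differ. As `h` has degree one, it moves the arguments at both ends
by the same amount `D`. But `h` exchanges the two ends, so applying it twice gives `2 * D = 0`: the
arguments agree, a contradiction. This already settles the based statement.

At a crossing fixed by `h` the two branches cannot be exchanged (`not_swaps_branches`). In a chart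
where they are the coordinate axes, `h` permutes the four rays by a rotation, and a quarter turn
cannot send each outgoing ray to the incoming ray of the other branch.

Hence both parameters of a fixed crossing are fixed modulo 1, and at most one crossing is fixed. The
crossing over a fixed parameter of `σ` is one. Since `h` acts on the crossings as an involution,
their number is odd (`odd_crossingNumber`), which settles the even case.

All arguments are measured in logarithmic coordinates: punctured germs at a point are lifted through
`exp` to maps near `Re z = -∞`. -/

/-! ### Logarithms and lifts of planar germs through `exp`. -/

/-- A continuous function on a preconnected set with integer values is constant. -/
theorem IsPreconnected.exists_int_eqOn {X : Type*} [TopologicalSpace X] {S : Set X}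
    (hS : IsPreconnected S) {f : X → ℝ} (hf : ContinuousOn f S)
    (hInt : ∀ x ∈ S, ∃ n : ℤ, f x = n) : ∃ n : ℤ, ∀ x ∈ S, f x = n := by
  have hd : IsDiscrete (range ((↑) : ℤ → ℝ)) :=
    ⟨Int.isClosedEmbedding_coe_real.toHomeomorph.symm.isEmbedding.discreteTopology⟩
  obtain ⟨y, ⟨n, rfl⟩, hy⟩ := hS.eqOn_const_of_mapsTo hd hf
    (fun x hx ↦ by obtain ⟨n, hn⟩ := hInt x hx; exact ⟨n, hn.symm⟩) ⟨_, 0, rfl⟩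
  exact ⟨n, fun x hx ↦ hy hx⟩

/-- Two continuous logarithms of the same function on a preconnected set differ by a constant
multiple of `2πi`. -/
theorem IsPreconnected.exists_eq_add_of_exp_eq {X : Type*} [TopologicalSpace X] {S : Set X}
    (hS : IsPreconnected S) {F G : X → ℂ} (hF : ContinuousOn F S) (hG : ContinuousOn G S)
    (h : ∀ x ∈ S, Complex.exp (F x) = Complex.exp (G x)) :
    ∃ n : ℤ, ∀ x ∈ S, F x = G x + n * (2 * Real.pi * Complex.I) := by
  have key : ∀ x ∈ S, ∃ n : ℤ, F x = G x + n * (2 * Real.pi * Complex.I) :=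
    fun x hx ↦ Complex.exp_eq_exp_iff_exists_int.1 (h x hx)
  have hval : ∀ x (n : ℤ), F x = G x + n * (2 * Real.pi * Complex.I) →
      (F x - G x).im / (2 * Real.pi) = n := by
    intro x n hn
    rw [hn]
    simp
  obtain ⟨n, hn⟩ := hS.exists_int_eqOn (f := fun x ↦ (F x - G x).im / (2 * Real.pi))
    ((Complex.continuous_im.comp_continuousOn (hF.sub hG)).div_const _)
    (fun x hx ↦ (key x hx).imp fun n hn ↦ hval x n hn)
  refine ⟨n, fun x hx ↦ ?_⟩
  obtain ⟨k, hk⟩ := key x hx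
  have : (k : ℝ) = n := (hval x k hk).symm.trans (hn x hx)
  rw [hk, Int.cast_injective this]

/-- A nonvanishing continuous function on a convex open set has a continuous logarithm. -/
theorem Convex.exists_continuousOn_log {V : Type*} [NormedAddCommGroup V] [NormedSpace ℝ V]
    {S : Set V} (hS : Convex ℝ S) (hne : S.Nonempty) (ho : IsOpen S) {g : V → ℂ}
    (hg : ContinuousOn g S) (h0 : ∀ x ∈ S, g x ≠ 0) :
    ∃ f : V → ℂ, ContinuousOn f S ∧ ∀ x ∈ S, Complex.exp (f x) = g x := by
  have := hS.contractibleSpace hne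
  have hsc : IsSimplyConnected S := (inferInstance : SimplyConnectedSpace S)
  exact Complex.exists_continuousOn_eqOn_exp_comp hsc ho hg
    (by rintro ⟨x, hx, h⟩; exact h0 x hx h)

/-- The left end of the complex plane: `z` tends to it iff `exp z` tends to `0`. -/
def leftEnd : Filter ℂ := comap Complex.re atBot

theorem leftEnd_eq_comap_exp : leftEnd = comap Complex.exp (𝓝[≠] 0) := by
  have h : Complex.exp ⁻¹' {0}ᶜ = univ := by ext z; simp [Complex.exp_ne_zero]
  rw [nhdsWithin, comap_inf, Complex.comap_exp_nhds_zero, comap_principal, h, principal_univ,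
    inf_top_eq, leftEnd]

theorem eventually_leftEnd_iff {p : ℂ → Prop} :
    (∀ᶠ z in leftEnd, p z) ↔ ∃ M : ℝ, ∀ z : ℂ, z.re < M → p z := by
  rw [leftEnd, (atBot_basis_Iio.comap Complex.re).eventually_iff]
  simp

theorem tendsto_exp_leftEnd : Tendsto Complex.exp leftEnd (𝓝[≠] 0) := by
  rw [leftEnd_eq_comap_exp]; exact tendsto_comap

theorem tendsto_leftEnd_iff {X : Type*} {l : Filter X} {F : X → ℂ} :
    Tendsto F l leftEnd ↔ Tendsto (fun x ↦ Complex.exp (F x)) l (𝓝[≠] 0) := by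
  rw [leftEnd_eq_comap_exp, tendsto_comap_iff]; rfl

theorem tendsto_add_leftEnd (k : ℤ) :
    Tendsto (fun z : ℂ ↦ z + k * (2 * Real.pi * Complex.I)) leftEnd leftEnd := by
  rw [tendsto_leftEnd_iff]
  simpa [Complex.exp_add, Complex.exp_int_mul_two_pi_mul_I] using tendsto_exp_leftEnd

/-- Uniqueness of logarithms near the left end. -/
theorem eventually_eq_add_of_exp_eq {F G : ℂ → ℂ} (hF : ∀ᶠ z in leftEnd, ContinuousAt F z)
    (hG : ∀ᶠ z in leftEnd, ContinuousAt G z)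
    (h : ∀ᶠ z in leftEnd, Complex.exp (F z) = Complex.exp (G z)) :
    ∃ n : ℤ, ∀ᶠ z in leftEnd, F z = G z + n * (2 * Real.pi * Complex.I) := by
  obtain ⟨M, hM⟩ := eventually_leftEnd_iff.1 (hF.and (hG.and h))
  obtain ⟨n, hn⟩ := (convex_halfSpace_re_lt M).isPreconnected.exists_eq_add_of_exp_eq
    (fun z hz ↦ (hM z hz).1.continuousWithinAt) (fun z hz ↦ (hM z hz).2.1.continuousWithinAt)
    (fun z hz ↦ (hM z hz).2.2)
  exact ⟨n, eventually_leftEnd_iff.2 ⟨M, hn⟩⟩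

/-- Translation behaviour under `2πi k`, given that under `2πi`. -/
theorem map_add_int_mul_two_pi {F : ℂ → ℂ} {d : ℤ} {M : ℝ}
    (h : ∀ z : ℂ, z.re < M →
      F (z + 2 * Real.pi * Complex.I) = F z + d * (2 * Real.pi * Complex.I))
    (z : ℂ) (hz : z.re < M) (k : ℤ) :
    F (z + k * (2 * Real.pi * Complex.I)) = F z + (d * k : ℤ) * (2 * Real.pi * Complex.I) := by
  have hre : ∀ k : ℤ, (z + k * (2 * Real.pi * Complex.I)).re < M := by
    intro k; simpa using hz
  induction k using Int.induction_on with
  | zero => simp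
  | succ n ih =>
    have := h _ (hre n)
    rw [ih] at this
    push_cast at this ⊢
    rw [← sub_eq_zero] at this ⊢
    rw [← this]; ring_nf
  | pred n ih =>
    have := h _ (hre (-n - 1))
    rw [show z + ((-n - 1 : ℤ) : ℂ) * (2 * Real.pi * Complex.I) + 2 * Real.pi * Complex.I =
      z + ((-n : ℤ) : ℂ) * (2 * Real.pi * Complex.I) by push_cast; ring, ih] at this
    push_cast at this ⊢
    linear_combination -this

/-- A continuous germ of the punctured plane at `0` lifts through `exp` near the left end. -/
theorem exists_lift_germ {f : ℂ → ℂ} (hf : Tendsto f (𝓝[≠] 0) (𝓝[≠] 0))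
    (hc : ∀ᶠ z in 𝓝[≠] 0, ContinuousAt f z) :
    ∃ (F : ℂ → ℂ) (d : ℤ), Tendsto F leftEnd leftEnd ∧ (∀ᶠ z in leftEnd, ContinuousAt F z) ∧
      (∀ᶠ z in leftEnd, Complex.exp (F z) = f (Complex.exp z)) ∧
      ∀ᶠ z in leftEnd, ∀ k : ℤ,
        F (z + k * (2 * Real.pi * Complex.I)) = F z + (d * k : ℤ) * (2 * Real.pi * Complex.I) := by
  have h0 : ∀ᶠ z in 𝓝[≠] 0, f z ≠ 0 := hf.eventually (eventually_mem_nhdsWithin)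
  obtain ⟨M, hM⟩ := eventually_leftEnd_iff.1 (tendsto_exp_leftEnd.eventually (hc.and h0))
  have ho : IsOpen {z : ℂ | z.re < M} := isOpen_lt Complex.continuous_re continuous_const
  have hconv := convex_halfSpace_re_lt M
  obtain ⟨F, hFc, hF⟩ := hconv.exists_continuousOn_log ⟨(M - 1 : ℝ), by simp⟩ ho
    (g := fun z ↦ f (Complex.exp z))
    (fun z hz ↦ ((hM z hz).1.comp Complex.continuous_exp.continuousAt).continuousWithinAt)
    (fun z hz ↦ (hM z hz).2)
  have hFat : ∀ z : ℂ, z.re < M → ContinuousAt F z := fun z hz ↦ hFc.continuousAt (ho.mem_nhds hz)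
  have hexp : ∀ᶠ z in leftEnd, Complex.exp (F z) = f (Complex.exp z) :=
    eventually_leftEnd_iff.2 ⟨M, hF⟩
  have hsh : ∀ z : ℂ, z.re < M → (z + 2 * Real.pi * Complex.I).re < M := by
    intro z hz; simpa using hz
  -- Both sides are logarithms of the same function on the half-plane; the integer `d` is the degree
  -- of the germ.
  obtain ⟨d, hd⟩ := hconv.isPreconnected.exists_eq_add_of_exp_eq
    (F := fun z ↦ F (z + 2 * Real.pi * Complex.I)) (G := F)
    (fun z hz ↦ (ContinuousAt.comp (f := fun z : ℂ ↦ z + 2 * Real.pi * Complex.I)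
      (hFat _ (hsh z hz)) (by fun_prop)).continuousWithinAt) hFc
    (fun z hz ↦ by
      rw [hF _ (hsh z hz), hF z hz, Complex.exp_add, Complex.exp_two_pi_mul_I, mul_one])
  refine ⟨F, d, ?_, eventually_leftEnd_iff.2 ⟨M, hFat⟩, hexp,
    eventually_leftEnd_iff.2 ⟨M, fun z hz ↦ map_add_int_mul_two_pi hd z hz⟩⟩
  rw [tendsto_leftEnd_iff]
  exact (hf.comp tendsto_exp_leftEnd).congr' (hexp.mono fun z hz ↦ hz.symm)

/-- An orientation-preserving homeomorphism with a fixed point `b` lifts through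
`z ↦ b + exp z` to a map commuting with the translation by `2πi`. -/
theorem OrientationPreserving.exists_lift {h : ℂ ≃ₜ ℂ} (hh : OrientationPreserving h) {b : ℂ}
    (hb : h b = b) :
    ∃ H : ℂ → ℂ, Continuous H ∧ (∀ z, Complex.exp (H z) = h (b + Complex.exp z) - b) ∧
      ∀ z (k : ℤ), H (z + k * (2 * Real.pi * Complex.I)) = H z + k * (2 * Real.pi * Complex.I) := by
  obtain ⟨H, hHc, hH⟩ := (convex_univ (𝕜 := ℝ) (E := ℂ)).exists_continuousOn_log univ_nonempty
    isOpen_univ (g := fun z ↦ h (b + Complex.exp z) - b)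
    ((h.continuous.comp (by fun_prop)).sub continuous_const).continuousOn
    (fun z _ hz ↦ by
      have : h (b + Complex.exp z) = h b := by rw [hb]; exact sub_eq_zero.1 hz
      have := h.injective this
      simp [Complex.exp_ne_zero] at this)
  rw [continuousOn_univ] at hHc
  replace hH : ∀ z, Complex.exp (H z) = h (b + Complex.exp z) - b := fun z ↦ hH z trivial
  obtain ⟨d, hd⟩ := isPreconnected_univ.exists_eq_add_of_exp_eq
    (F := fun z ↦ H (z + 2 * Real.pi * Complex.I)) (G := H)
    (by fun_prop) hHc.continuousOn
    (fun z _ ↦ by rw [hH, hH, Complex.exp_add, Complex.exp_two_pi_mul_I, mul_one])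
  -- The unit circle about `b` suffices: along it `H` and `θ` differ by a constant, so the degree
  -- `d` is the winding number.
  obtain ⟨θ, hθc, hθ, hper⟩ := hh b 1 one_pos
  obtain ⟨n, hn⟩ := isPreconnected_univ.exists_eq_add_of_exp_eq
    (F := fun t : ℝ ↦ H (2 * Real.pi * t * Complex.I)) (G := θ)
    (by fun_prop) hθc.continuousOn
    (fun t _ ↦ by
      have := hθ t
      simp only [ClosedCurve.map, ClosedCurve.circle, circleMap, hb] at this
      rw [hH, sub_eq_iff_eq_add', ← this]
      simp)
  have hd1 : d = 1 := by
    have e1 := hn 1 trivial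
    have e0 := hn 0 trivial
    have e2 := hd 0 trivial
    have e3 := hper 0
    simp only [zero_add, Complex.ofReal_one, Complex.ofReal_zero, mul_one, mul_zero, zero_mul,
      Int.cast_one] at e0 e1 e2 e3
    rw [e1, e0, e3] at e2
    have : ((d : ℂ) - 1) * (2 * Real.pi * Complex.I) = 0 := by linear_combination -e2
    rcases mul_eq_zero.1 this with h | h
    · exact_mod_cast sub_eq_zero.1 h
    · exact absurd h Complex.two_pi_I_ne_zero
  subst hd1
  refine ⟨H, hHc, hH, fun z k ↦ ?_⟩
  have := map_add_int_mul_two_pi (F := H) (d := 1) (M := z.re + 1) (fun z _ ↦ hd z trivial) z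
    (by simp) k
  simpa using this

/-! ### Degree-one maps preserving finitely many directions. -/

/-- A self-map of the line of degree one that preserves integrality in both directions acts on
the integers as a translation. -/
theorem apply_int_eq_add_of_degree_one {φ : ℝ → ℝ} (hφ : Continuous φ) {N : ℕ} (hN : 0 < N)
    (hper : ∀ y, φ (y + N) = φ y + N)
    (hInt : ∀ y : ℝ, (∃ j : ℤ, y = j) ↔ ∃ j : ℤ, φ y = j) (j : ℤ) : φ j = φ 0 + j := by
  -- A larger jump would take the integer value `φ j + 1` strictly between `j` and `j + 1`. Then `φ
  -- j - j` is antitone and `N`-periodic, hence constant; injectivity of `φ` plays no role.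
  have step : ∀ j : ℤ, φ (j + 1) ≤ φ j + 1 := by
    intro j
    obtain ⟨m, hm⟩ := (hInt j).1 ⟨j, rfl⟩
    by_contra! hlt
    obtain ⟨y, ⟨hy1, hy2⟩, hy⟩ := intermediate_value_Ioo (by linarith : (j : ℝ) ≤ j + 1)
      hφ.continuousOn ⟨by linarith, hlt⟩
    obtain ⟨k, rfl⟩ := (hInt y).2 ⟨m + 1, by rw [hy, hm]; push_cast; ring⟩
    have h1 : j < k := by exact_mod_cast hy1
    have h2 : k < j + 1 := by exact_mod_cast hy2
    omega
  let g : ℤ → ℝ := fun j ↦ φ j - j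
  have hanti : Antitone g := antitone_int_of_succ_le fun j ↦ by
    have := step j
    simp only [g]; push_cast; linarith
  have hgper : Function.Periodic g (N : ℤ) := fun j ↦ by
    have := hper j
    simp only [g]; push_cast; rw [this]; ring
  have hg : g j = g 0 := by
    have hN' : (0 : ℤ) < N := by exact_mod_cast hN
    apply le_antisymm
    · have h1 : g (j + j.natAbs * N) = g j := by simpa using hgper.nat_mul j.natAbs j
      rw [← h1]
      exact hanti (by nlinarith [neg_abs_le j, abs_nonneg j, Int.natCast_natAbs j])
    · have h1 : g (j - j.natAbs * N) = g j := by simpa using hgper.sub_nat_mul_eq j.natAbs (x := j)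
      rw [← h1]
      exact hanti (by nlinarith [le_abs_self j, abs_nonneg j, Int.natCast_natAbs j])
  have : φ j - j = φ 0 - 0 := by simpa [g] using hg
  linarith

/-- If `K` commutes with `2πi` near the left end and preserves the `N` horizontal directions with
imaginary part in `(2π/N)ℤ`, then it acts on them as a translation. -/
theorem exists_im_eq_add_of_preserves_lines {N : ℕ} (hN : 0 < N) {K : ℂ → ℂ}
    (hc : ∀ᶠ w in leftEnd, ContinuousAt K w)
    (hper : ∀ᶠ w in leftEnd, ∀ k : ℤ,
      K (w + k * (2 * Real.pi * Complex.I)) = K w + k * (2 * Real.pi * Complex.I))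
    (hA : ∀ᶠ w in leftEnd, (∃ j : ℤ, w.im = j * (2 * Real.pi / N)) ↔
      ∃ j : ℤ, (K w).im = j * (2 * Real.pi / N)) :
    ∃ n : ℤ, ∀ᶠ w in leftEnd, ∀ j : ℤ, w.im = j * (2 * Real.pi / N) →
      (K w).im = (j + n : ℤ) * (2 * Real.pi / N) := by
  obtain ⟨M, hM⟩ := eventually_leftEnd_iff.1 (hc.and (hper.and hA))
  set c : ℝ := 2 * Real.pi / N with hcdef
  have hN' : (0 : ℝ) < N := by exact_mod_cast hN
  have hc0 : 0 < c := by positivity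
  have hcN : c * N = 2 * Real.pi := by rw [hcdef]; field_simp
  -- On each vertical line `Re w = x`, heights are measured in units of `c`, so the preserved
  -- directions become the integers and the period `2π` becomes `N`.
  let φ : ℝ → ℝ → ℝ := fun x y ↦ (K ⟨x, y * c⟩).im / c
  have hmk : Continuous fun p : ℝ × ℝ ↦ (⟨p.1, p.2 * c⟩ : ℂ) := by
    have : (fun p : ℝ × ℝ ↦ (⟨p.1, p.2 * c⟩ : ℂ)) =
        fun p ↦ (p.1 : ℂ) + ((p.2 * c : ℝ) : ℂ) * Complex.I := by
      funext p
      apply Complex.ext <;> simp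
    rw [this]; fun_prop
  have hφx : ∀ x < M, ∀ j : ℤ, φ x j = φ x 0 + j := by
    intro x hx
    apply apply_int_eq_add_of_degree_one _ hN
    · intro y
      have := (hM ⟨x, y * c⟩ hx).2.1 1
      have e : (⟨x, (y + N) * c⟩ : ℂ) = ⟨x, y * c⟩ + (1 : ℤ) * (2 * Real.pi * Complex.I) := by
        apply Complex.ext <;> simp
        linarith
      simp only [φ]
      rw [e, this]
      simp only [Complex.add_im, add_div]
      congr 1
      simp [← hcN]
      field_simp
    · intro y
      have := (hM ⟨x, y * c⟩ hx).2.2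
      simp only [φ, div_eq_iff hc0.ne']
      rw [← this]
      simp only [mul_left_inj' hc0.ne']
    · refine continuous_iff_continuousAt.2 fun y ↦ ?_
      have h1 : ContinuousAt (fun y : ℝ ↦ (⟨x, y * c⟩ : ℂ)) y :=
        (hmk.comp (Continuous.prodMk_right x)).continuousAt
      exact (Complex.continuous_im.continuousAt.comp
        (ContinuousAt.comp (g := K) (f := fun y : ℝ ↦ (⟨x, y * c⟩ : ℂ))
          (hM ⟨x, y * c⟩ hx).1 h1)).div_const _
  obtain ⟨n, hn⟩ := (isPreconnected_Iio (a := M)).exists_int_eqOn (f := fun x ↦ φ x 0)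
    (fun x hx ↦ by
      have h1 : ContinuousAt (fun x : ℝ ↦ (⟨x, 0 * c⟩ : ℂ)) x :=
        (hmk.comp (Continuous.prodMk_left 0)).continuousAt
      exact ((Complex.continuous_im.continuousAt.comp
        (ContinuousAt.comp (g := K) (f := fun x : ℝ ↦ (⟨x, 0 * c⟩ : ℂ))
          (hM ⟨x, 0 * c⟩ hx).1 h1)).div_const _).continuousWithinAt)
    (fun x hx ↦ by
      obtain ⟨j, hj⟩ := (hM ⟨x, 0 * c⟩ hx).2.2.1 ⟨0, by simp⟩
      exact ⟨j, by simp only [φ, div_eq_iff hc0.ne', hj]⟩)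
  refine ⟨n, eventually_leftEnd_iff.2 ⟨M, fun w hw j hj ↦ ?_⟩⟩
  have h1 := hφx w.re hw j
  rw [hn _ hw] at h1
  have h2 : (⟨w.re, j * c⟩ : ℂ) = w := Complex.ext rfl hj.symm
  simp only [φ, h2, div_eq_iff hc0.ne'] at h1
  rw [h1]; push_cast; ring

/-- The expression of an orientation-preserving homeomorphism in a chart at a fixed point,
lifted through `exp`. Here `H` lifts `h`, `E` lifts the chart and `K` lifts `e ∘ h ∘ e⁻¹`. -/
theorem OrientationPreserving.exists_chart_lift {h : ℂ ≃ₜ ℂ} (hh : OrientationPreserving h)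
    {b : ℂ} (hb : h b = b) {e : OpenPartialHomeomorph ℂ ℂ} (hbe : b ∈ e.source) (he : e b = 0) :
    ∃ (H E K : ℂ → ℂ) (d q : ℤ),
      (Continuous H ∧ (∀ z, Complex.exp (H z) = h (b + Complex.exp z) - b)) ∧
      (∀ᶠ z in leftEnd, ContinuousAt E z) ∧
      (∀ᶠ z in leftEnd, Complex.exp (E z) = e (b + Complex.exp z)) ∧
      (∀ᶠ z in leftEnd, ∀ k : ℤ,
        E (z + k * (2 * Real.pi * Complex.I)) = E z + (d * k : ℤ) * (2 * Real.pi * Complex.I)) ∧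
      Tendsto E leftEnd leftEnd ∧
      (∀ᶠ w in leftEnd, ContinuousAt K w) ∧
      (∀ᶠ w in leftEnd, ∀ k : ℤ,
        K (w + k * (2 * Real.pi * Complex.I)) = K w + k * (2 * Real.pi * Complex.I)) ∧
      (∀ᶠ w in leftEnd, Complex.exp (K w) = e (h (e.symm (Complex.exp w)))) ∧
      ∀ᶠ z in leftEnd, K (E z) = E (H z) + q * (2 * Real.pi * Complex.I) := by
  obtain ⟨H, hHc, hH, hHper⟩ := hh.exists_lift hb
  have hadd : Tendsto (fun z : ℂ ↦ b + z) (𝓝 0) (𝓝 b) := by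
    have : Continuous fun z : ℂ ↦ b + z := by fun_prop
    simpa using this.tendsto 0
  have hsrc : ∀ᶠ z : ℂ in 𝓝 0, b + z ∈ e.source := hadd.eventually (e.open_source.mem_nhds hbe)
  have h0t : (0 : ℂ) ∈ e.target := he ▸ e.map_source hbe
  have hsymm0 : e.symm 0 = b := by rw [← he, e.left_inv hbe]
  have htgt : ∀ᶠ z : ℂ in 𝓝 0, z ∈ e.target := e.open_target.mem_nhds h0t
  have hne : ∀ᶠ z : ℂ in 𝓝[≠] 0, z ≠ 0 := eventually_mem_nhdsWithin
  have hfe : Tendsto (fun z ↦ e (b + z)) (𝓝[≠] 0) (𝓝[≠] 0) := by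
    refine tendsto_nhdsWithin_iff.2 ⟨?_, ?_⟩
    · have := (e.continuousAt hbe).tendsto.comp hadd
      rw [he] at this
      exact this.mono_left nhdsWithin_le_nhds
    · filter_upwards [hsrc.filter_mono nhdsWithin_le_nhds, hne] with z hz hz0 h1
      have h1 : e (b + z) = 0 := h1
      rw [← he] at h1
      exact hz0 (by simpa using e.injOn hz hbe h1)
  have hfp : Tendsto (fun z ↦ e.symm z - b) (𝓝[≠] 0) (𝓝[≠] 0) := by
    refine tendsto_nhdsWithin_iff.2 ⟨?_, ?_⟩
    · have := (e.continuousAt_symm h0t).tendsto.sub_const b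
      rw [hsymm0, sub_self] at this
      exact this.mono_left nhdsWithin_le_nhds
    · filter_upwards [htgt.filter_mono nhdsWithin_le_nhds, hne] with z hz hz0 h1
      have h1 : e.symm z = e.symm 0 := by rw [hsymm0]; exact sub_eq_zero.1 h1
      exact hz0 (e.symm.injOn hz h0t h1)
  obtain ⟨E, d, hEt, hEc, hE, hEper⟩ := exists_lift_germ hfe (by
    filter_upwards [hsrc.filter_mono nhdsWithin_le_nhds] with z hz
    exact (e.continuousAt hz).comp (f := fun z ↦ b + z) (by fun_prop))
  obtain ⟨P, d', hPt, hPc, hP, hPper⟩ := exists_lift_germ hfp (by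
    filter_upwards [htgt.filter_mono nhdsWithin_le_nhds] with z hz
    exact (e.continuousAt_symm hz).sub continuousAt_const)
  have hHt : Tendsto H leftEnd leftEnd := by
    rw [tendsto_leftEnd_iff]
    simp only [hH]
    have : Tendsto (fun z ↦ h (b + z) - b) (𝓝[≠] 0) (𝓝[≠] 0) := by
      refine tendsto_nhdsWithin_iff.2 ⟨?_, ?_⟩
      · have := ((h.continuous.tendsto b).comp hadd).sub_const b
        rw [hb, sub_self] at this
        exact this.mono_left nhdsWithin_le_nhds
      · filter_upwards [hne] with z hz0 h1
        have h1 : h (b + z) = h b := by rw [hb]; exact sub_eq_zero.1 h1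
        exact hz0 (by simpa using h.injective h1)
    exact this.comp tendsto_exp_leftEnd
  have hexpsrc : ∀ᶠ z in leftEnd, b + Complex.exp z ∈ e.source :=
    tendsto_exp_leftEnd.eventually (hsrc.filter_mono nhdsWithin_le_nhds)
  have hexptgt : ∀ᶠ z in leftEnd, Complex.exp z ∈ e.target :=
    tendsto_exp_leftEnd.eventually (htgt.filter_mono nhdsWithin_le_nhds)
  obtain ⟨c, hPE⟩ := eventually_eq_add_of_exp_eq (F := fun z ↦ P (E z)) (G := id)
    (by filter_upwards [hEc, hEt.eventually hPc] with z h1 h2 using h2.comp h1)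
    (Eventually.of_forall fun z ↦ continuousAt_id) (by
      filter_upwards [hE, hEt.eventually hP, hexpsrc] with z h1 h2 h3
      rw [h2, h1, e.left_inv h3, id, add_sub_cancel_left])
  obtain ⟨c', hEP⟩ := eventually_eq_add_of_exp_eq (F := fun z ↦ E (P z)) (G := id)
    (by filter_upwards [hPc, hPt.eventually hEc] with z h1 h2 using h2.comp h1)
    (Eventually.of_forall fun z ↦ continuousAt_id) (by
      filter_upwards [hP, hPt.eventually hE, hexptgt] with z h1 h2 h3
      rw [h2, h1, add_sub_cancel, e.right_inv h3, id])
  have hleft : leftEnd.NeBot := by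
    rw [leftEnd]
    exact atBot_neBot.comap_of_surj Complex.re_surjective
  -- `E ∘ P` is a translation near the left end, so the degrees of chart and inverse chart multiply
  -- to 1. Compare its values at `z` and `z + 2πi`.
  have hdd : d * d' = 1 := by
    obtain ⟨z, h1, h2, h3, h4⟩ := (hEP.and (((tendsto_add_leftEnd 1).eventually hEP).and
      (hPper.and (hPt.eventually hEper)))).exists
    rw [h3 1, h4, h1] at h2
    have h5 : ((d * d' : ℤ) - 1 : ℂ) * (2 * Real.pi * Complex.I) = 0 := by
      simp only [id] at h2
      push_cast at h2 ⊢
      linear_combination h2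
    rcases mul_eq_zero.1 h5 with h | h
    · exact_mod_cast sub_eq_zero.1 h
    · exact absurd h Complex.two_pi_I_ne_zero
  -- `K = E ∘ H ∘ P` has degree `d * 1 * d' = 1` even when the chart reverses orientation. Since `P
  -- ∘ E` is translation by `c` periods, passing through `E` turns these into `d * c`.
  refine ⟨H, E, fun w ↦ E (H (P w)), d, d * c, ⟨hHc, hH⟩, hEc, hE, hEper, hEt, ?_, ?_, ?_, ?_⟩
  · filter_upwards [hPc, (hHt.comp hPt).eventually hEc] with w h1 h2
    exact ContinuousAt.comp (g := E) (f := fun w ↦ H (P w)) h2 (hHc.continuousAt.comp h1)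
  · filter_upwards [hPper, (hHt.comp hPt).eventually hEper] with w h1 h2 k
    simp only [Function.comp_apply] at h2
    rw [h1, hHper, h2, ← mul_assoc d, hdd, one_mul]
  · filter_upwards [hP, (hHt.comp hPt).eventually hE] with w h1 h2
    simp only [Function.comp_apply] at h2
    rw [h2, hH, h1, add_sub_cancel, add_sub_cancel]
  · filter_upwards [hPE, hHt.eventually hEper] with z h1 h2
    rw [h1, hHper, id, h2]

/-! ### Local structure of generic curves. -/

/-- A continuous injective function on an interval around `t`, vanishing at `t`, changes sign at
`t` and takes all values close to `0`. -/
theorem exists_sign_change_of_injOn {φ : ℝ → ℝ} {t ε : ℝ} (hε : 0 < ε)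
    (hc : ContinuousOn φ (Metric.ball t ε)) (hi : InjOn φ (Metric.ball t ε)) (h0 : φ t = 0) :
    ∃ κ : ℝ, (∀ᶠ u in 𝓝[>] t, 0 < κ * φ u) ∧ (∀ᶠ u in 𝓝[<] t, κ * φ u < 0) ∧
      ∀ᶠ y in 𝓝 (0 : ℝ), ∃ u, |u - t| < ε ∧ φ u = y := by
  have mono : ∀ ψ : ℝ → ℝ, ContinuousOn ψ (Metric.ball t ε) → ψ t = 0 →
      StrictMonoOn ψ (Ioo (t - ε) (t + ε)) →
      (∀ᶠ u in 𝓝[>] t, 0 < ψ u) ∧ (∀ᶠ u in 𝓝[<] t, ψ u < 0) ∧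
      ∀ᶠ y in 𝓝 (0 : ℝ), ∃ u, |u - t| < ε ∧ ψ u = y := by
    intro ψ hψc hψ0 hψ
    have ht : t ∈ Ioo (t - ε) (t + ε) := ⟨by linarith, by linarith⟩
    refine ⟨?_, ?_, ?_⟩
    · filter_upwards [Ioo_mem_nhdsGT (show t < t + ε by linarith)] with u hu
      rw [← hψ0]
      exact hψ ht ⟨by linarith [hu.1], hu.2⟩ hu.1
    · filter_upwards [Ioo_mem_nhdsLT (show t - ε < t by linarith)] with u hu
      rw [← hψ0]
      exact hψ ⟨hu.1, by linarith [hu.2]⟩ ht hu.2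
    · have h1 : ψ (t - ε / 2) < 0 := by
        rw [← hψ0]; exact hψ ⟨by linarith, by linarith⟩ ht (by linarith)
      have h2 : 0 < ψ (t + ε / 2) := by
        rw [← hψ0]; exact hψ ht ⟨by linarith, by linarith⟩ (by linarith)
      filter_upwards [Ioo_mem_nhds h1 h2] with y hy
      have hsub : Icc (t - ε / 2) (t + ε / 2) ⊆ Metric.ball t ε := by
        rw [Real.ball_eq_Ioo]
        exact fun u hu ↦ ⟨by linarith [hu.1], by linarith [hu.2]⟩
      obtain ⟨u, hu, rfl⟩ := intermediate_value_Icc (by linarith) (hψc.mono hsub)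
        (Ioo_subset_Icc_self hy)
      exact ⟨u, by simpa [Real.dist_eq] using hsub hu, rfl⟩
  have hlt : t - ε < t + ε := by linarith
  have hball := Real.ball_eq_Ioo t ε
  rcases ContinuousOn.strictMonoOn_of_injOn_Ioo hlt (hball ▸ hc) (hball ▸ hi) with h | h
  · exact ⟨1, by simpa using mono φ hc h0 h⟩
  · obtain ⟨h1, h2, h3⟩ := mono (fun u ↦ -φ u) hc.neg (by simp [h0])
      (fun u hu v hv huv ↦ neg_lt_neg (h hu hv huv))
    refine ⟨-1, by simpa using h1, by simpa using h2, ?_⟩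
    have hneg : Tendsto (fun y : ℝ ↦ -y) (𝓝 0) (𝓝 0) := by
      simpa using (continuous_neg (G := ℝ)).tendsto 0
    filter_upwards [hneg.eventually h3] with y hy
    obtain ⟨u, hu, hu'⟩ := hy
    exact ⟨u, hu, neg_injective hu'⟩

namespace ClosedCurve

theorem SameParam.symm {s t : ℝ} (h : SameParam s t) : SameParam t s := by
  obtain ⟨n, rfl⟩ := h
  exact ⟨-n, by push_cast; ring⟩

theorem SameParam.trans {s t u : ℝ} (h : SameParam s t) (h' : SameParam t u) :
    SameParam s u := by
  obtain ⟨n, rfl⟩ := h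
  obtain ⟨m, rfl⟩ := h'
  exact ⟨n + m, by push_cast; ring⟩

theorem SameParam.eq_of_abs_sub_lt {s t : ℝ} (h : SameParam s t) (hst : |s - t| < 1) : s = t := by
  obtain ⟨n, rfl⟩ := h
  have : |(n : ℝ)| < 1 := by simpa using hst
  have : n = 0 := Int.abs_lt_one_iff.1 (by exact_mod_cast this)
  simp [this]

variable {C : ClosedCurve}

theorem toFun_add_int (C : ClosedCurve) (t : ℝ) (n : ℤ) : C.toFun (t + n) = C.toFun t := by
  simpa using C.periodic_toFun.int_mul n t

theorem SameParam.toFun_eq {s t : ℝ} (h : SameParam s t) : C.toFun s = C.toFun t := by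
  obtain ⟨n, rfl⟩ := h
  rw [toFun_add_int]

theorem sameParam_of_notMem_crossings {s t : ℝ} (h : C.toFun t ∉ C.crossings)
    (hst : C.toFun s = C.toFun t) : SameParam s t := by
  by_contra hn
  exact h ⟨s, t, hn, hst, rfl⟩

/-- In one period there are only finitely many parameters of crossing points. -/
theorem IsGeneric.finite_crossing_params (hC : C.IsGeneric) (c : ℝ) :
    {u ∈ Ico c (c + 1) | C.toFun u ∈ C.crossings}.Finite := by
  have hfib : ∀ x, {u ∈ Ico c (c + 1) | C.toFun u = x}.Finite := by
    intro x
    have hper : ∀ u ∈ Ico c (c + 1), ∀ v ∈ Ico c (c + 1), SameParam u v → u = v := by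
      intro u hu v hv h
      refine h.eq_of_abs_sub_lt ?_
      rw [abs_lt]
      constructor <;> linarith [hu.1, hu.2, hv.1, hv.2]
    by_contra hinf
    obtain ⟨F, hF, hcard⟩ := (Set.Infinite.exists_subset_card_eq hinf 3)
    obtain ⟨a, b, d, hab, had, hbd, rfl⟩ := Finset.card_eq_three.1 hcard
    have ha := hF (show a ∈ _ by simp)
    have hb := hF (show b ∈ _ by simp)
    have hd := hF (show d ∈ _ by simp)
    rcases hC.double a b d (ha.2.trans hb.2.symm) (hb.2.trans hd.2.symm) with h | h | h
    · exact hab (hper _ ha.1 _ hb.1 h)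
    · exact hbd (hper _ hb.1 _ hd.1 h)
    · exact had (hper _ ha.1 _ hd.1 h)
  refine (hC.finite_crossings.biUnion fun x _ ↦ hfib x).subset fun u hu ↦ ?_
  simp only [mem_iUnion]
  exact ⟨_, hu.2, hu.1, rfl⟩

/-- A generic curve is locally injective. -/
theorem IsGeneric.exists_injOn_ball (hC : C.IsGeneric) (t : ℝ) :
    ∃ ε > 0, InjOn C.toFun (Metric.ball t ε) := by
  -- The parameter `t` is removed because it may itself lie over a crossing. Close to `t` no other
  -- parameter does, whereas two distinct parameters with one image would both lie over a crossing.
  have hfin := (hC.finite_crossing_params (t - 1 / 2)).subset (sdiff_subset (t := {t}))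
  have hmem : t ∉ {u ∈ Ico (t - 1 / 2) (t - 1 / 2 + 1) | C.toFun u ∈ C.crossings} \ {t} := by simp
  obtain ⟨ε, hε, hball⟩ := Metric.mem_nhds_iff.1 (hfin.isClosed.isOpen_compl.mem_nhds hmem)
  refine ⟨min ε (1 / 2), by positivity, fun u hu v hv huv ↦ ?_⟩
  by_contra hne
  have hu1 : |u - t| < min ε (1 / 2) := hu
  have hv1 : |v - t| < min ε (1 / 2) := hv
  obtain ⟨hu2, hu3⟩ := lt_min_iff.1 hu1
  obtain ⟨hv2, hv3⟩ := lt_min_iff.1 hv1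
  have huv1 : |u - v| < 1 := by
    rw [abs_lt] at *
    constructor <;> linarith
  have hns : ¬ SameParam u v := fun h ↦ hne (h.eq_of_abs_sub_lt huv1)
  have hall : ∀ x, |x - t| < ε → |x - t| < 1 / 2 → C.toFun x ∈ C.crossings → x = t := by
    intro x hx hx' hcr
    by_contra hxt
    rw [abs_lt] at hx'
    exact hball (show x ∈ Metric.ball t ε from hx)
      ⟨⟨⟨by linarith, by linarith⟩, hcr⟩, hxt⟩
  exact hne ((hall u hu2 hu3 ⟨u, v, hns, rfl, huv.symm⟩).trans
    (hall v hv2 hv3 ⟨u, v, hns, huv, rfl⟩).symm)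

/-- A property that holds along the curve near each passage through `b` holds at all points of
the curve near `b`. -/
theorem eventually_of_mem_support {b : ℂ} {P : ℂ → Prop}
    (h : ∀ u, C.toFun u = b → ∀ᶠ v in 𝓝 u, P (C.toFun v)) :
    ∀ᶠ x in 𝓝 b, x ∈ C.support → P x := by
  have := (isCompact_Icc (a := (0 : ℝ)) (b := 1)).eventually_forall_of_forall_eventually
    (x₀ := b) (P := fun x u ↦ C.toFun u = x → P x) (fun u _ ↦ by
      by_cases hu : C.toFun u = b
      · have := (continuous_snd.tendsto (b, u)).eventually (h u hu)
        filter_upwards [this] with z hz hzx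
        exact hzx ▸ hz
      · have : ∀ᶠ z : ℂ × ℝ in 𝓝 (b, u), C.toFun z.2 ≠ z.1 :=
          (isOpen_ne_fun (C.continuous_toFun.comp continuous_snd) continuous_fst).mem_nhds hu
        filter_upwards [this] with z hz hzx
        exact absurd hzx hz)
  filter_upwards [this] with x hx
  rintro ⟨u, rfl⟩
  refine hx (Int.fract u) ⟨Int.fract_nonneg u, (Int.fract_lt_one u).le⟩ ?_
  exact SameParam.toFun_eq ⟨⌊u⌋, (Int.fract_add_floor u).symm⟩

theorem eventually_toFun_of_sameParam {s t : ℝ} (h : SameParam s t) {P : ℂ → Prop}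
    (hP : ∀ᶠ v in 𝓝 s, P (C.toFun v)) : ∀ᶠ v in 𝓝 t, P (C.toFun v) := by
  obtain ⟨n, rfl⟩ := h
  have hc : Continuous fun v : ℝ ↦ v - n := by fun_prop
  have : Tendsto (fun v : ℝ ↦ v - n) (𝓝 (s + n)) (𝓝 s) := by
    simpa using hc.tendsto (s + n)
  filter_upwards [this.eventually hP] with v hv
  have := C.toFun_add_int (v - n) n
  rw [sub_add_cancel] at this
  rwa [this]

/-- A branch of a generic curve running in the real axis of a chart centred at one of its points
runs through the origin monotonically. -/
theorem IsGeneric.exists_sign_change (hC : C.IsGeneric) {t ε : ℝ} (hε : 0 < ε)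
    {e : OpenPartialHomeomorph ℂ ℂ} (h0 : e (C.toFun t) = 0) {f : ℂ → ℝ} (hf : Continuous f)
    (hfi : ∀ u v, |u - t| < ε → |v - t| < ε → f (e (C.toFun u)) = f (e (C.toFun v)) →
      e (C.toFun u) = e (C.toFun v)) (hf0 : f 0 = 0)
    (hsrc : ∀ u, |u - t| < ε → C.toFun u ∈ e.source) :
    ∃ κ : ℝ, (∀ᶠ u in 𝓝[>] t, 0 < κ * f (e (C.toFun u))) ∧
      (∀ᶠ u in 𝓝[<] t, κ * f (e (C.toFun u)) < 0) ∧
      ∀ᶠ y in 𝓝 (0 : ℝ), ∃ u, |u - t| < ε ∧ f (e (C.toFun u)) = y := by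
  obtain ⟨δ, hδ, hinj⟩ := hC.exists_injOn_ball t
  have hle : ∀ u, |u - t| < min ε δ → |u - t| < ε ∧ |u - t| < δ := fun u hu ↦ lt_min_iff.1 hu
  obtain ⟨κ, h1, h2, h3⟩ := exists_sign_change_of_injOn (φ := fun u ↦ f (e (C.toFun u)))
    (t := t) (lt_min hε hδ)
    (fun u hu ↦ (hf.continuousAt.comp ((e.continuousAt (hsrc u (hle u hu).1)).comp
      C.continuous_toFun.continuousAt)).continuousWithinAt)
    (fun u hu v hv huv ↦ hinj (hle u hu).2 (hle v hv).2
      (e.injOn (hsrc u (hle u hu).1) (hsrc v (hle v hv).1)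
        (hfi u v (hle u hu).1 (hle v hv).1 huv)))
    (by rw [h0, hf0])
  exact ⟨κ, h1, h2, h3.mono fun y ⟨u, hu, hy⟩ ↦ ⟨u, (hle u hu).1, hy⟩⟩

theorem eventually_abs_sub_lt (t : ℝ) {ε : ℝ} (hε : 0 < ε) : ∀ᶠ u in 𝓝 t, |u - t| < ε :=
  Metric.ball_mem_nhds t hε

/-- Near a point that is not a crossing, a generic curve is the real axis of a chart. -/
theorem IsGeneric.exists_flat_chart (hC : C.IsGeneric) {t : ℝ} (ht : C.toFun t ∉ C.crossings) :
    ∃ e : OpenPartialHomeomorph ℂ ℂ, C.toFun t ∈ e.source ∧ e (C.toFun t) = 0 ∧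
      (∀ᶠ x in 𝓝 (C.toFun t), x ∈ C.support ↔ (e x).im = 0) ∧
      ∃ κ : ℝ, (∀ᶠ u in 𝓝[>] t, 0 < κ * (e (C.toFun u)).re) ∧
        ∀ᶠ u in 𝓝[<] t, κ * (e (C.toFun u)).re < 0 := by
  obtain ⟨e₀, ε, hε, he₀⟩ := hC.locallyFlat t
  have ht₀ := he₀ t (by simpa using hε)
  -- Translating the chart puts the point at the origin and keeps the branch in the real axis.
  let e := e₀.transHomeomorph (Homeomorph.subRight (e₀ (C.toFun t)))
  have hsrc : e.source = e₀.source := rfl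
  have hval : ∀ x, e x = e₀ x - e₀ (C.toFun t) := fun x ↦ rfl
  have hbr : ∀ u, |u - t| < ε → C.toFun u ∈ e.source ∧ (e (C.toFun u)).im = 0 := by
    intro u hu
    refine ⟨(he₀ u hu).1, ?_⟩
    rw [hval, Complex.sub_im, (he₀ u hu).2, ht₀.2, sub_zero]
  have hmem : C.toFun t ∈ e.source := ht₀.1
  have h0 : e (C.toFun t) = 0 := by rw [hval, sub_self]
  obtain ⟨κ, h1, h2, h3⟩ := hC.exists_sign_change hε h0 Complex.continuous_re
    (fun u v hu hv h ↦ Complex.ext h (by rw [(hbr u hu).2, (hbr v hv).2])) Complex.zero_re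
    (fun u hu ↦ (hbr u hu).1)
  refine ⟨e, hmem, h0, ?_, κ, h1, h2⟩
  -- Local flatness only places one branch inside the axis. Here the absence of other branches puts
  -- all nearby curve points on the axis; the converse holds because `h3` lets the branch cover the
  -- axis near 0.
  have hto := C.eventually_of_mem_support (b := C.toFun t) (P := fun x ↦ (e x).im = 0)
    (fun u hu ↦ eventually_toFun_of_sameParam (P := fun x ↦ (e x).im = 0)
      (sameParam_of_notMem_crossings ht hu).symm
      ((eventually_abs_sub_lt t hε).mono fun v hv ↦ (hbr v hv).2))
  have hcont : Tendsto (fun x ↦ (e x).re) (𝓝 (C.toFun t)) (𝓝 0) := by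
    have := (Complex.continuous_re.tendsto _).comp (e.continuousAt hmem).tendsto
    rwa [h0, Complex.zero_re] at this
  filter_upwards [hto, hcont.eventually h3, e.open_source.mem_nhds hmem] with x hx hx3 hxs
  refine ⟨hx, fun him ↦ ?_⟩
  obtain ⟨u, hu, hre⟩ := hx3
  refine ⟨u, e.injOn (hbr u hu).1 hxs (Complex.ext hre ?_)⟩
  rw [(hbr u hu).2, him]

/-- Near a crossing point, a generic curve is the union of the coordinate axes of a chart. -/
theorem IsGeneric.exists_cross_chart (hC : C.IsGeneric) {s t : ℝ} (hst : ¬ SameParam s t)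
    (hq : C.toFun s = C.toFun t) :
    ∃ e : OpenPartialHomeomorph ℂ ℂ, C.toFun s ∈ e.source ∧ e (C.toFun s) = 0 ∧
      (∀ᶠ x in 𝓝 (C.toFun s), x ∈ C.support ↔ (e x).re = 0 ∨ (e x).im = 0) ∧
      (∀ᶠ u in 𝓝 s, (e (C.toFun u)).im = 0) ∧ (∀ᶠ u in 𝓝 t, (e (C.toFun u)).re = 0) ∧
      (∃ κ : ℝ, (∀ᶠ u in 𝓝[>] s, 0 < κ * (e (C.toFun u)).re) ∧
        ∀ᶠ u in 𝓝[<] s, κ * (e (C.toFun u)).re < 0) ∧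
      ∃ κ : ℝ, (∀ᶠ u in 𝓝[>] t, 0 < κ * (e (C.toFun u)).im) ∧
        ∀ᶠ u in 𝓝[<] t, κ * (e (C.toFun u)).im < 0 := by
  obtain ⟨e, ε, hε, hs, ht⟩ := hC.transverse s t hst hq
  have hs₀ := hs s (by simpa using hε)
  have ht₀ := ht t (by simpa using hε)
  have h0 : e (C.toFun s) = 0 := Complex.ext (by rw [hq]; exact ht₀.2) hs₀.2
  have hs' := (eventually_abs_sub_lt s hε).mono fun v hv ↦ (hs v hv).2
  have ht' := (eventually_abs_sub_lt t hε).mono fun v hv ↦ (ht v hv).2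
  obtain ⟨κ, h1, h2, h3⟩ := hC.exists_sign_change hε h0 Complex.continuous_re
    (fun u v hu hv h ↦ Complex.ext h (by rw [(hs u hu).2, (hs v hv).2])) Complex.zero_re
    (fun u hu ↦ (hs u hu).1)
  obtain ⟨κ', h1', h2', h3'⟩ := hC.exists_sign_change hε (hq ▸ h0) Complex.continuous_im
    (fun u v hu hv h ↦ Complex.ext (by rw [(ht u hu).2, (ht v hv).2]) h) Complex.zero_im
    (fun u hu ↦ (ht u hu).1)
  refine ⟨e, hs₀.1, h0, ?_, hs', ht', ⟨κ, h1, h2⟩, κ', h1', h2'⟩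
  have hto := C.eventually_of_mem_support (b := C.toFun s)
    (P := fun x ↦ (e x).re = 0 ∨ (e x).im = 0) (fun u hu ↦ by
      rcases hC.double u s t hu hq with h | h | h
      · exact eventually_toFun_of_sameParam (P := fun x ↦ (e x).re = 0 ∨ (e x).im = 0) h.symm
          (hs'.mono fun v hv ↦ Or.inr hv)
      · exact absurd h hst
      · exact eventually_toFun_of_sameParam (P := fun x ↦ (e x).re = 0 ∨ (e x).im = 0) h.symm
          (ht'.mono fun v hv ↦ Or.inl hv))
  have hcont := (e.continuousAt hs₀.1).tendsto
  rw [h0] at hcont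
  have hre : Tendsto (fun x ↦ (e x).re) (𝓝 (C.toFun s)) (𝓝 0) :=
    (Complex.continuous_re.tendsto' 0 0 rfl).comp hcont
  have him : Tendsto (fun x ↦ (e x).im) (𝓝 (C.toFun s)) (𝓝 0) :=
    (Complex.continuous_im.tendsto' 0 0 rfl).comp hcont
  filter_upwards [hto, hre.eventually h3, him.eventually h3', e.open_source.mem_nhds hs₀.1]
    with x hx hx3 hx3' hxs
  refine ⟨hx, ?_⟩
  rintro (h | h)
  · obtain ⟨u, hu, hu'⟩ := hx3'
    exact ⟨u, e.injOn (ht u hu).1 hxs (Complex.ext (by rw [(ht u hu).2, h]) hu')⟩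
  · obtain ⟨u, hu, hu'⟩ := hx3
    exact ⟨u, e.injOn (hs u hu).1 hxs (Complex.ext hu' (by rw [(hs u hu).2, h]))⟩

end ClosedCurve

/-- In logarithmic coordinates a line is 2 directions per period and a cross is 4; the quotients by
`(2 : ℕ)` and `(4 : ℕ)` match the `N` of `exists_im_eq_add_of_preserves_lines`. -/
theorem Complex.exp_im_eq_zero_iff (w : ℂ) :
    (Complex.exp w).im = 0 ↔ ∃ j : ℤ, w.im = j * (2 * Real.pi / (2 : ℕ)) := by
  rw [Complex.exp_im, mul_eq_zero, or_iff_right (Real.exp_pos _).ne', Real.sin_eq_zero_iff]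
  refine exists_congr fun j ↦ ?_
  rw [eq_comm]; push_cast; ring_nf

theorem Complex.exp_re_eq_zero_or_im_eq_zero_iff (w : ℂ) :
    ((Complex.exp w).re = 0 ∨ (Complex.exp w).im = 0) ↔
      ∃ j : ℤ, w.im = j * (2 * Real.pi / (4 : ℕ)) := by
  rw [Complex.exp_re, Complex.exp_im, mul_eq_zero, mul_eq_zero,
    or_iff_right (Real.exp_pos _).ne', or_iff_right (Real.exp_pos _).ne']
  have h : Real.cos w.im = 0 ∨ Real.sin w.im = 0 ↔ Real.sin (2 * w.im) = 0 := by
    rw [Real.sin_two_mul, mul_eq_zero, mul_eq_zero, or_iff_right (two_ne_zero), or_comm]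
  rw [h, Real.sin_eq_zero_iff]
  refine exists_congr fun j ↦ ?_
  push_cast
  constructor <;> intro h <;> linarith

/-- Complex numbers with the same argument modulo a common translation. -/
theorem Complex.exp_eq_of_im_eq_add {w w' : ℂ} {a : ℝ} (h : w'.im = w.im + a) :
    ∃ ρ : ℝ, 0 < ρ ∧ Complex.exp w' = ρ * Complex.exp (a * Complex.I) * Complex.exp w := by
  refine ⟨Real.exp (w'.re - w.re), Real.exp_pos _, ?_⟩
  rw [Complex.ofReal_exp, ← Complex.exp_add, ← Complex.exp_add]
  congr 1
  apply Complex.ext <;> simp [h]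
  ring

/-! ### Reversing homeomorphisms near their fixed points on the curve. -/

namespace ClosedCurve

/-- The homeomorphism `h` of the plane maps `C` to itself, acting on the parameters by the
orientation-reversing map `σ`. -/
structure ReversedBy (C : ClosedCurve) (h : ℂ ≃ₜ ℂ) (σ : ℝ → ℝ) : Prop where
  strictAnti : StrictAnti σ
  continuous : Continuous σ
  surjective : Function.Surjective σ
  map_add_one : ∀ t, σ (t + 1) = σ t - 1
  map_toFun : ∀ t, h (C.toFun t) = C.toFun (σ t)

theorem exists_reversedBy_of_sendsTo {C : ClosedCurve} {h : ℂ ≃ₜ ℂ}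
    (hs : SendsTo h C C.reverse) : ∃ σ, C.ReversedBy h σ := by
  obtain ⟨ρ, hρ, hC⟩ := hs
  refine ⟨fun t ↦ -ρ t, fun s t hst ↦ neg_lt_neg (ρ.strictMono hst), ρ.continuous.neg,
    fun y ↦ ⟨ρ.symm (-y), by simp⟩, fun t ↦ ?_, hC⟩
  rw [hρ]; ring

variable {C : ClosedCurve} {h : ℂ ≃ₜ ℂ} {σ : ℝ → ℝ}

theorem eventually_nhdsLT_of_sameParam {s t : ℝ} (hst : SameParam s t) {P : ℂ → Prop}
    (hP : ∀ᶠ u in 𝓝[<] s, P (C.toFun u)) : ∀ᶠ u in 𝓝[<] t, P (C.toFun u) := by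
  obtain ⟨k, rfl⟩ := hst
  have hc : Continuous fun v : ℝ ↦ v - k := by fun_prop
  have : Tendsto (fun v : ℝ ↦ v - k) (𝓝[<] (s + k)) (𝓝[<] s) :=
    tendsto_nhdsWithin_iff.2 ⟨(hc.tendsto' (s + k) s (by simp)).mono_left nhdsWithin_le_nhds,
      eventually_mem_nhdsWithin.mono fun v (hv : v < s + k) ↦ by
        show v - k < s
        linarith⟩
  filter_upwards [this.eventually hP] with v hv
  have := C.toFun_add_int (v - k) k
  rw [sub_add_cancel] at this
  rwa [this]

namespace ReversedBy

theorem map_add_int (hσ : C.ReversedBy h σ) (t : ℝ) (n : ℤ) : σ (t + n) = σ t - n := by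
  have hp : Function.Periodic (fun t ↦ σ t + t) 1 := fun t ↦ by
    simp only [hσ.map_add_one]; ring
  have := hp.int_mul n t
  simp only [mul_one] at this
  linarith

theorem add_int (hσ : C.ReversedBy h σ) (n : ℤ) : C.ReversedBy h fun t ↦ σ t + n where
  strictAnti := fun s t hst ↦ by simpa using hσ.strictAnti hst
  continuous := hσ.continuous.add continuous_const
  surjective := fun y ↦ by
    obtain ⟨x, hx⟩ := hσ.surjective (y - n)
    exact ⟨x, by simp [hx]⟩
  map_add_one := fun t ↦ by rw [hσ.map_add_one]; ring
  map_toFun := fun t ↦ by rw [toFun_add_int, hσ.map_toFun]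

theorem sameParam_iff (hσ : C.ReversedBy h σ) {s t : ℝ} :
    SameParam (σ s) (σ t) ↔ SameParam s t := by
  constructor
  · rintro ⟨n, hn⟩
    refine ⟨-n, hσ.strictAnti.injective ?_⟩
    rw [hσ.map_add_int, hn]; push_cast; ring
  · rintro ⟨n, rfl⟩
    exact ⟨-n, by rw [hσ.map_add_int]; push_cast; ring⟩

theorem map_mem_support_iff (hσ : C.ReversedBy h σ) {x : ℂ} : h x ∈ C.support ↔ x ∈ C.support := by
  constructor
  · rintro ⟨u, hu⟩
    obtain ⟨v, rfl⟩ := hσ.surjective u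
    rw [← hσ.map_toFun] at hu
    exact ⟨v, h.injective hu⟩
  · rintro ⟨u, rfl⟩
    exact ⟨σ u, (hσ.map_toFun u).symm⟩

theorem tendsto_nhdsGT (hσ : C.ReversedBy h σ) (t : ℝ) : Tendsto σ (𝓝[>] t) (𝓝[<] (σ t)) :=
  tendsto_nhdsWithin_iff.2 ⟨(hσ.continuous.tendsto t).mono_left nhdsWithin_le_nhds,
    eventually_mem_nhdsWithin.mono fun _ hu ↦ hσ.strictAnti hu⟩

theorem tendsto_nhdsLT (hσ : C.ReversedBy h σ) (t : ℝ) : Tendsto σ (𝓝[<] t) (𝓝[>] (σ t)) :=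
  tendsto_nhdsWithin_iff.2 ⟨(hσ.continuous.tendsto t).mono_left nhdsWithin_le_nhds,
    eventually_mem_nhdsWithin.mono fun _ hu ↦ hσ.strictAnti hu⟩

/-- If the curve is given by the equation `A (e x)` near a fixed point of `h`, then
`e ∘ h ∘ e⁻¹` preserves `A`. -/
theorem eventually_chart_iff (hσ : C.ReversedBy h σ) {b : ℂ} (hb : h b = b)
    {e : OpenPartialHomeomorph ℂ ℂ} (hbe : b ∈ e.source) (he : e b = 0) {A : ℂ → Prop}
    (hA : ∀ᶠ x in 𝓝 b, x ∈ C.support ↔ A (e x)) :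
    ∀ᶠ w in leftEnd, A (Complex.exp w) ↔ A (e (h (e.symm (Complex.exp w)))) := by
  have h0t : (0 : ℂ) ∈ e.target := he ▸ e.map_source hbe
  have hsymm : Tendsto e.symm (𝓝 0) (𝓝 b) := by
    have := (e.continuousAt_symm h0t).tendsto
    rwa [← he, e.left_inv hbe, he] at this
  have hh : Tendsto h (𝓝 b) (𝓝 b) := by simpa [hb] using h.continuous.tendsto b
  refine (tendsto_exp_leftEnd.mono_right nhdsWithin_le_nhds).eventually
    (p := fun z ↦ A z ↔ A (e (h (e.symm z)))) ?_
  filter_upwards [hsymm.eventually hA, (hh.comp hsymm).eventually hA,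
    e.open_target.mem_nhds h0t] with z h1 h2 h3
  rw [e.right_inv h3] at h1
  rw [← h1, ← hσ.map_mem_support_iff]
  exact h2

/-- An orientation-preserving homeomorphism reversing a generic curve fixes no point of the curve
other than a crossing. -/
theorem not_fixed_of_notMem_crossings (hσ : C.ReversedBy h σ) (hh : OrientationPreserving h)
    (hC : C.IsGeneric) {t : ℝ} (ht : C.toFun t ∉ C.crossings) : σ t ≠ t := by
  intro hfix
  set b := C.toFun t with hbdef
  have hb : h b = b := by rw [hbdef, hσ.map_toFun, hfix]
  obtain ⟨e, hbe, he, hsupp, κ, hκ1, hκ2⟩ := hC.exists_flat_chart ht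
  obtain ⟨H, E, K, d, q, ⟨hHc, hH⟩, hEc, hE, hEper, hEt, hKc, hKper, hK, hKE⟩ :=
    hh.exists_chart_lift hb hbe he
  obtain ⟨n, hn⟩ := exists_im_eq_add_of_preserves_lines (N := 2) two_pos hKc hKper (by
    filter_upwards [hσ.eventually_chart_iff (A := fun z ↦ z.im = 0) hb hbe he hsupp, hK] with w h1 h2
    rw [← Complex.exp_im_eq_zero_iff, ← Complex.exp_im_eq_zero_iff, h2, h1])
  -- the lift of the curve, cut open at `b`
  have hne : ∀ u ∈ Ioo t (t + 1), C.toFun u ≠ b := by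
    intro u hu hub
    have := (sameParam_of_notMem_crossings ht hub).eq_of_abs_sub_lt
      (by rw [abs_lt]; constructor <;> linarith [hu.1, hu.2])
    exact hu.1.ne' this
  obtain ⟨θ, hθc, hθ⟩ := (convex_Ioo t (t + 1)).exists_continuousOn_log
    (nonempty_Ioo.2 (by linarith)) isOpen_Ioo (g := fun u ↦ C.toFun u - b)
    (C.continuous_toFun.sub continuous_const).continuousOn
    (fun u hu ↦ sub_ne_zero.2 (hne u hu))
  -- The shift by 1 makes the reflection preserve the interval `(t, t + 1)` and exchange its ends.
  let τ : ℝ → ℝ := fun u ↦ σ u + (1 : ℤ)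
  have hτ : C.ReversedBy h τ := hσ.add_int 1
  have hτt : τ t = t + 1 := by simp [τ, hfix]
  have hτt' : τ (t + 1) = t := by rw [hτ.map_add_one, hτt]; ring
  have hτmaps : ∀ u ∈ Ioo t (t + 1), τ u ∈ Ioo t (t + 1) := fun u hu ↦
    ⟨hτt' ▸ hτ.strictAnti hu.2, hτt ▸ hτ.strictAnti hu.1⟩
  -- The global input: one integer `m` serves the whole cut-open curve, hence both ends.
  obtain ⟨m, hm⟩ := (isPreconnected_Ioo (a := t) (b := t + 1)).exists_eq_add_of_exp_eq
    (F := fun u ↦ H (θ u)) (G := fun u ↦ θ (τ u)) (hHc.comp_continuousOn hθc)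
    (hθc.comp hτ.continuous.continuousOn hτmaps)
    (fun u hu ↦ by
      rw [hH, hθ u hu, add_sub_cancel, hτ.map_toFun, hθ _ (hτmaps u hu)])
  have hIoo1 : ∀ᶠ u in 𝓝[>] t, u ∈ Ioo t (t + 1) := Ioo_mem_nhdsGT (by linarith)
  have hIoo2 : ∀ᶠ u in 𝓝[<] (t + 1), u ∈ Ioo t (t + 1) := Ioo_mem_nhdsLT (by linarith)
  have hθtend : ∀ l : Filter ℝ, (∀ᶠ u in l, u ∈ Ioo t (t + 1)) → Tendsto C.toFun l (𝓝 b) →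
      Tendsto θ l leftEnd := by
    intro l hl hlim
    rw [tendsto_leftEnd_iff, tendsto_nhdsWithin_iff]
    refine ⟨?_, Eventually.of_forall fun u ↦ Complex.exp_ne_zero _⟩
    have : Tendsto (fun u ↦ C.toFun u - b) l (𝓝 0) := by simpa using hlim.sub_const b
    exact this.congr' (hl.mono fun u hu ↦ (hθ u hu).symm)
  have hγ1 : Tendsto C.toFun (𝓝[>] t) (𝓝 b) :=
    (C.continuous_toFun.tendsto t).mono_left nhdsWithin_le_nhds
  have hγ2 : Tendsto C.toFun (𝓝[<] (t + 1)) (𝓝 b) := by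
    have := (C.continuous_toFun.tendsto (t + 1)).mono_left (nhdsWithin_le_nhds (s := Iio (t + 1)))
    rwa [C.periodic_toFun] at this
  have hθ1 := hθtend _ hIoo1 hγ1
  have hθ2 := hθtend _ hIoo2 hγ2
  have hτ1 : Tendsto τ (𝓝[>] t) (𝓝[<] (t + 1)) := hτt ▸ hτ.tendsto_nhdsGT t
  have hτ2 : Tendsto τ (𝓝[<] (t + 1)) (𝓝[>] t) := by
    have := hτ.tendsto_nhdsLT (t + 1)
    rwa [hτt'] at this
  have hexp : ∀ l : Filter ℝ, (∀ᶠ u in l, u ∈ Ioo t (t + 1)) → Tendsto θ l leftEnd →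
      ∀ᶠ u in l, Complex.exp (E (θ u)) = e (C.toFun u) := by
    intro l hl hlim
    filter_upwards [hl, hlim.eventually hE] with u h1 h2
    rw [h2, hθ u h1, add_sub_cancel]
  have hInt : ∀ l : Filter ℝ, (∀ᶠ u in l, u ∈ Ioo t (t + 1)) → Tendsto θ l leftEnd →
      Tendsto C.toFun l (𝓝 b) →
      ∀ᶠ u in l, ∃ j : ℤ, (E (θ u)).im = j * (2 * Real.pi / (2 : ℕ)) := by
    intro l hl hlim hγ
    filter_upwards [hexp l hl hlim, hγ.eventually hsupp] with u h1 h2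
    rw [← Complex.exp_im_eq_zero_iff, h1, ← h2]
    exact ⟨u, rfl⟩
  -- along both ends of the curve, `τ` shifts the argument by the same amount
  obtain ⟨D, hD⟩ : ∃ D : ℝ, ∀ l l' : Filter ℝ, (∀ᶠ u in l, u ∈ Ioo t (t + 1)) →
      Tendsto θ l leftEnd → Tendsto θ l' leftEnd → Tendsto C.toFun l (𝓝 b) → Tendsto τ l l' →
      ∀ᶠ u in l, (E (θ (τ u))).im = (E (θ u)).im + D := by
    -- `K` turns every axis direction by `n` half turns; `m` periods from `hm`, seen through `E`,
    -- and `q` from `hKE` are subtracted. None of these depends on the end.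
    refine ⟨n * Real.pi - (d * m + q : ℤ) * (2 * Real.pi), fun l l' hl hlim hlim' hγ hll' ↦ ?_⟩
    filter_upwards [hl, hInt l hl hlim hγ, hlim.eventually hKE, (hlim'.comp hll').eventually hEper,
      (hEt.comp hlim).eventually hn] with u h1 h2 h3 h4 h5
    obtain ⟨j, hj⟩ := h2
    have h6 := h5 j hj
    simp only [Function.comp_apply] at h4 h6
    rw [h3, hm u h1, h4] at h6
    simp at h6 hj
    push_cast
    linarith
  have hD1 := hD _ _ hIoo1 hθ1 hθ2 hγ1 hτ1
  have hD2 := hD _ _ hIoo2 hθ2 hθ1 hγ2 hτ2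
  obtain ⟨a, ha⟩ : ∃ a : ℝ, ∀ᶠ u in 𝓝[>] t, (E (θ u)).im = a := by
    have hcont : ∀ᶠ u in 𝓝[>] t, ContinuousAt (fun u ↦ E (θ u)) u := by
      filter_upwards [hIoo1, hθ1.eventually hEc] with u h1 h2
      exact ContinuousAt.comp (f := θ) h2 (hθc.continuousAt (isOpen_Ioo.mem_nhds h1))
    obtain ⟨y, hy, hsub⟩ := mem_nhdsGT_iff_exists_Ioo_subset.1 (hcont.and (hInt _ hIoo1 hθ1 hγ1))
    have hpi : (2 * Real.pi / (2 : ℕ)) ≠ 0 := by simp [Real.pi_ne_zero]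
    obtain ⟨k, hk⟩ := (isPreconnected_Ioo (a := t) (b := y)).exists_int_eqOn
      (f := fun u ↦ (E (θ u)).im / (2 * Real.pi / (2 : ℕ)))
      (fun u hu ↦ ((Complex.continuous_im.continuousAt.comp
        (hsub hu).1).div_const _).continuousWithinAt)
      (fun u hu ↦ by
        obtain ⟨j, hj⟩ := (hsub hu).2
        exact ⟨j, by rw [hj, mul_div_cancel_right₀ _ hpi]⟩)
    refine ⟨k * (2 * Real.pi / (2 : ℕ)), ?_⟩
    filter_upwards [Ioo_mem_nhdsGT hy] with u hu
    exact (div_eq_iff hpi).1 (hk u hu)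
  have hκ2' : ∀ᶠ u in 𝓝[<] (t + 1), κ * (e (C.toFun u)).re < 0 :=
    eventually_nhdsLT_of_sameParam (P := fun x ↦ κ * (e x).re < 0) ⟨1, by simp⟩ hκ2
  obtain ⟨u, h1, h2, h3, h4, h5, h6, h7, h8⟩ := (hD1.and ((hτ1.eventually hD2).and (ha.and
    (((hτ2.comp hτ1).eventually ha).and (hκ1.and ((hτ1.eventually hκ2').and
    ((hexp _ hIoo1 hθ1).and (hτ1.eventually (hexp _ hIoo2 hθ2))))))))).exists
  simp only [Function.comp_apply] at h4
  -- Two applications of `τ` return to the first end, where the argument is the constant `a`; so `2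
  -- * D = 0`, and the two ends lie on one ray, against the signs recorded by `κ`.
  have hD0 : (E (θ (τ u))).im = (E (θ u)).im + 0 := by linarith
  obtain ⟨ρ, hρ, hρe⟩ := Complex.exp_eq_of_im_eq_add hD0
  rw [h7, h8] at hρe
  simp only [Complex.ofReal_zero, zero_mul, Complex.exp_zero, mul_one] at hρe
  rw [hρe, Complex.re_ofReal_mul] at h6
  have : 0 < ρ * (κ * (e (C.toFun u)).re) := mul_pos hρ h5
  linarith

/-- An orientation-preserving homeomorphism reversing a generic curve does not exchange the two
branches at a crossing. -/
theorem not_swaps_branches (hσ : C.ReversedBy h σ) (hh : OrientationPreserving h)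
    (hC : C.IsGeneric) {s t : ℝ} (hst : ¬ SameParam s t) (hq : C.toFun s = C.toFun t)
    (h1 : SameParam t (σ s)) (h2 : SameParam s (σ t)) : False := by
  set b := C.toFun s with hbdef
  have hb : h b = b := by rw [hbdef, hσ.map_toFun, ← h1.toFun_eq, ← hq]
  obtain ⟨e, hbe, he, hsupp, hs0, ht0, ⟨κ, hκ1, hκ2⟩, κ', hκ1', hκ2'⟩ :=
    hC.exists_cross_chart hst hq
  obtain ⟨H, E, K, d, q, -, -, -, -, -, hKc, hKper, hK, -⟩ := hh.exists_chart_lift hb hbe he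
  obtain ⟨n, hn⟩ := exists_im_eq_add_of_preserves_lines (N := 4) four_pos hKc hKper (by
    filter_upwards [hσ.eventually_chart_iff (A := fun z ↦ z.re = 0 ∨ z.im = 0) hb hbe he hsupp, hK]
      with w h1 h2
    rw [← Complex.exp_re_eq_zero_or_im_eq_zero_iff, ← Complex.exp_re_eq_zero_or_im_eq_zero_iff,
      h2, h1])
  -- On the cross, `h` acts in the chart as the rotation by `ζ = i ^ n`, up to a positive factor
  -- varying with the point.
  obtain ⟨ζ, hζ⟩ : ∃ ζ : ℂ, ∀ᶠ z in 𝓝[≠] (0 : ℂ), z.re = 0 ∨ z.im = 0 →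
      ∃ ρ : ℝ, 0 < ρ ∧ e (h (e.symm z)) = ρ * ζ * z := by
    refine ⟨Complex.exp ((n * (2 * Real.pi / (4 : ℕ)) : ℝ) * Complex.I), ?_⟩
    rw [← Complex.map_exp_comap_re_atBot, eventually_map]
    change ∀ᶠ w in leftEnd, _
    filter_upwards [hn, hK] with w hw hKw hcross
    obtain ⟨j, hj⟩ := (Complex.exp_re_eq_zero_or_im_eq_zero_iff w).1 hcross
    rw [← hKw]
    refine Complex.exp_eq_of_im_eq_add ?_
    rw [hw j hj, hj]; push_cast; ring
  have hrot : ∀ l : Filter ℝ, Tendsto C.toFun l (𝓝 b) → (∀ᶠ u in l, C.toFun u ≠ b) →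
      ∀ᶠ u in l, ∃ ρ : ℝ, 0 < ρ ∧ e (C.toFun (σ u)) = ρ * ζ * e (C.toFun u) := by
    intro l hl hne
    have hsrc := hl.eventually (e.open_source.mem_nhds hbe)
    have hlim : Tendsto (fun u ↦ e (C.toFun u)) l (𝓝[≠] 0) := by
      refine tendsto_nhdsWithin_iff.2 ⟨?_, ?_⟩
      · have := (e.continuousAt hbe).tendsto.comp hl
        rwa [he] at this
      · filter_upwards [hsrc, hne] with u hu hub h0
        exact hub (e.injOn hu hbe (Eq.trans h0 he.symm))
    filter_upwards [hlim.eventually hζ, hsrc, hl.eventually hsupp] with u hu hus hsu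
    have := hu (hsu.1 ⟨u, rfl⟩)
    rwa [e.left_inv hus, hσ.map_toFun] at this
  have hγs : Tendsto C.toFun (𝓝[>] s) (𝓝 b) :=
    (C.continuous_toFun.tendsto s).mono_left nhdsWithin_le_nhds
  have hγt : Tendsto C.toFun (𝓝[>] t) (𝓝 b) :=
    hq ▸ (C.continuous_toFun.tendsto t).mono_left nhdsWithin_le_nhds
  have hnes : ∀ᶠ u in 𝓝[>] s, C.toFun u ≠ b := hκ1.mono fun u hu hub ↦ by
    rw [hub, he] at hu; simp at hu
  have hnet : ∀ᶠ u in 𝓝[>] t, C.toFun u ≠ b := hκ1'.mono fun u hu hub ↦ by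
    rw [hub, he] at hu; simp at hu
  obtain ⟨u, ⟨ρ, hρ, hu⟩, hu1, hu2, hu3, hu4⟩ := ((hrot _ hγs hnes).and (hκ1.and
    ((hs0.filter_mono nhdsWithin_le_nhds).and
    (((hσ.tendsto_nhdsGT s).eventually
      (eventually_nhdsLT_of_sameParam h1 (P := fun x ↦ κ' * (e x).im < 0) hκ2')).and
    ((hσ.tendsto_nhdsGT s).eventually
      (eventually_nhdsLT_of_sameParam h1 (P := fun x ↦ (e x).re = 0) (ht0.filter_mono nhdsWithin_le_nhds))))))).exists
  obtain ⟨v, ⟨ρ', hρ', hv⟩, hv1, hv2, hv3, hv4⟩ := ((hrot _ hγt hnet).and (hκ1'.and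
    ((ht0.filter_mono nhdsWithin_le_nhds).and
    (((hσ.tendsto_nhdsGT t).eventually
      (eventually_nhdsLT_of_sameParam h2 (P := fun x ↦ κ * (e x).re < 0) hκ2)).and
    ((hσ.tendsto_nhdsGT t).eventually
      (eventually_nhdsLT_of_sameParam h2 (P := fun x ↦ (e x).im = 0) (hs0.filter_mono nhdsWithin_le_nhds))))))).exists
  generalize e (C.toFun u) = z₁ at *
  generalize e (C.toFun v) = z₂ at *
  generalize e (C.toFun (σ u)) = z₃ at *
  generalize e (C.toFun (σ v)) = z₄ at *
  -- The same `ζ.im` enters with opposite signs, real to imaginary and imaginary to real, while both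
  -- outgoing rays must become incoming ones. Multiplying the two sign conditions gives a negative
  -- multiple of `ζ.im ^ 2`, although the outgoing signs make it nonnegative.
  have e1 : z₃.im = ρ * (ζ.im * z₁.re) := by
    rw [hu, mul_assoc, Complex.im_ofReal_mul, Complex.mul_im, hu2]; ring
  have e2 : z₄.re = -(ρ' * (ζ.im * z₂.im)) := by
    rw [hv, mul_assoc, Complex.re_ofReal_mul, Complex.mul_re, hv2]; ring
  rw [e1] at hu3
  rw [e2] at hv3
  have p1 : κ' * (ζ.im * z₁.re) < 0 := by
    by_contra! hc
    have := mul_nonneg hρ.le hc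
    linarith
  have p2 : 0 < κ * (ζ.im * z₂.im) := by
    by_contra! hc
    have := mul_nonpos_of_nonneg_of_nonpos hρ'.le hc
    linarith
  have p3 := mul_neg_of_neg_of_pos p1 p2
  have p4 := mul_nonneg (mul_pos hu1 hv1).le (sq_nonneg ζ.im)
  linarith

end ReversedBy

end ClosedCurve

/-! ### Fixed parameters and the parity of the number of crossings. -/

namespace ClosedCurve

theorem exists_sameParam_mem_Ico (t u : ℝ) : ∃ v ∈ Ico t (t + 1), SameParam v u :=
  ⟨t + Int.fract (u - t), ⟨by linarith [Int.fract_nonneg (u - t)],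
    by linarith [Int.fract_lt_one (u - t)]⟩, ⌊u - t⌋, by linarith [Int.fract_add_floor (u - t)]⟩

namespace ReversedBy

variable {C : ClosedCurve} {h : ℂ ≃ₜ ℂ} {σ : ℝ → ℝ}

theorem exists_fixed_param (hσ : C.ReversedBy h σ) : ∃ t, σ t = t := by
  have hc : Continuous fun t ↦ σ t - t := hσ.continuous.sub continuous_id
  obtain ⟨n, hn⟩ := exists_nat_ge |σ 0|
  have h1 := hσ.map_add_int 0 n
  have h2 := hσ.map_add_int 0 (-n)
  push_cast at h1 h2
  rw [zero_add] at h1 h2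
  obtain ⟨hl, hr⟩ := abs_le.1 hn
  have hn0 : (0 : ℝ) ≤ n := n.cast_nonneg
  obtain ⟨t, ht⟩ := mem_range_of_exists_le_of_exists_ge (c := 0) hc
    ⟨(n : ℝ), by rw [h1]; linarith⟩ ⟨-(n : ℝ), by rw [h2]; linarith⟩
  exact ⟨t, sub_eq_zero.1 ht⟩

/-- An orientation-reversing map of the circle has at most two fixed points. -/
theorem sameParam_of_fixed (hσ : C.ReversedBy h σ) {t u v : ℝ} (ht : σ t = t)
    (hu : SameParam u (σ u)) (hv : SameParam v (σ v)) (hut : ¬ SameParam t u)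
    (hvt : ¬ SameParam t v) : SameParam u v := by
  have key : ∀ u, SameParam u (σ u) → ¬ SameParam t u →
      ∃ u₀, SameParam u₀ u ∧ σ u₀ = u₀ - 1 := by
    intro u hu hut
    obtain ⟨u₀, hu₀, hs⟩ := exists_sameParam_mem_Ico t u
    refine ⟨u₀, hs, ?_⟩
    have hlt : t < u₀ := lt_of_le_of_ne hu₀.1 fun h ↦ hut (h ▸ hs)
    -- As `t < u₀ < t + 1`, monotonicity gives `t - 1 < σ u₀ < t`, which leaves only `k = -1`. The
    -- decreasing function `σ u - u` takes the value `-1` at most once.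
    obtain ⟨k, hk⟩ := (hs.trans hu).trans (hσ.sameParam_iff.2 hs.symm)
    have h1 := hσ.strictAnti hlt
    have h2 := hσ.strictAnti hu₀.2
    rw [hσ.map_add_one] at h2
    have hk1 : k < 0 := by
      have : (k : ℝ) < 0 := by linarith
      exact_mod_cast this
    have hk2 : -2 < k := by
      have : (-2 : ℝ) < k := by linarith [hu₀.2]
      exact_mod_cast this
    obtain rfl : k = -1 := by omega
    rw [hk]; push_cast; ring
  obtain ⟨u₀, hu₀, hu'⟩ := key u hu hut
  obtain ⟨v₀, hv₀, hv'⟩ := key v hv hvt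
  have : u₀ = v₀ := by
    rcases lt_trichotomy u₀ v₀ with h | h | h
    · have := hσ.strictAnti h
      linarith
    · exact h
    · have := hσ.strictAnti h
      linarith
  exact hu₀.symm.trans (this ▸ hv₀)

theorem map_mem_crossings (hσ : C.ReversedBy h σ) {x : ℂ} (hx : x ∈ C.crossings) :
    h x ∈ C.crossings := by
  obtain ⟨s, t, hst, rfl, ht⟩ := hx
  exact ⟨σ s, σ t, fun hs ↦ hst (hσ.sameParam_iff.1 hs), (hσ.map_toFun s).symm,
    by rw [← hσ.map_toFun, ht]⟩

/-- If some parameter is fixed, then `h` acts on the crossings as an involution. -/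
theorem map_map_crossing (hσ : C.ReversedBy h σ) (hC : C.IsGeneric) {t : ℝ} (ht : σ t = t)
    {x : ℂ} (hx : x ∈ C.crossings) : h (h x) = x := by
  let T := {u ∈ Ico t (t + 1) | C.toFun u ∈ C.crossings}
  have : Finite T := (hC.finite_crossing_params t).to_subtype
  have hmono : StrictMono fun u ↦ σ (σ u) := fun u v huv ↦ hσ.strictAnti (hσ.strictAnti huv)
  have h1 : σ (σ (t + 1)) = t + 1 := by
    have := hσ.map_add_int t (-1)
    rw [hσ.map_add_one, ht, sub_eq_add_neg]
    push_cast at this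
    rw [this, ht]; ring
  let f : T → T := fun u ↦ ⟨σ (σ u), ⟨by
      have := hmono.monotone u.2.1.1
      simp only [ht] at this
      exact this, by
      have := hmono u.2.1.2
      simp only [h1] at this
      exact this⟩, by
    rw [← hσ.map_toFun, ← hσ.map_toFun]
    exact hσ.map_mem_crossings (hσ.map_mem_crossings u.2.2)⟩
  have hf : StrictMono f := fun u v huv ↦ hmono huv
  -- A strictly increasing self-map of a finite linear order is the identity.
  have hid : ∀ u : T, f u = u := fun u ↦ le_antisymm hf.apply_le hf.le_apply
  obtain ⟨s, _, _, rfl, -⟩ := id hx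
  obtain ⟨u, hu, hus⟩ := exists_sameParam_mem_Ico t s
  have hval : C.toFun u = C.toFun s := hus.toFun_eq
  have hfix : σ (σ u) = u := congrArg Subtype.val (hid ⟨u, hu, by rwa [hval]⟩)
  rw [← hval, hσ.map_toFun, hσ.map_toFun, hfix]

/-- A generic curve that is reversed by an orientation-preserving homeomorphism has an odd number
of crossings. -/
theorem odd_crossingNumber (hσ : C.ReversedBy h σ) (hh : OrientationPreserving h)
    (hC : C.IsGeneric) : Odd C.crossingNumber := by
  classical
  obtain ⟨t, ht⟩ := hσ.exists_fixed_param
  have hp : C.toFun t ∈ C.crossings := by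
    by_contra hp
    exact hσ.not_fixed_of_notMem_crossings hh hC hp ht
  have huniq : ∀ x ∈ C.crossings, h x = x → x = C.toFun t := by
    rintro _ ⟨u, v, huv, rfl, hv⟩ hfix
    have hu' : C.toFun (σ u) = C.toFun u := by rw [← hσ.map_toFun, hfix]
    have hv' : C.toFun (σ v) = C.toFun v := by rw [← hσ.map_toFun, hv, hfix]
    by_contra hne
    have hut : ¬ SameParam t u := fun h ↦ hne h.toFun_eq.symm
    have hvt : ¬ SameParam t v := fun h ↦ hne (hv.symm.trans h.toFun_eq.symm)
    -- Modulo 1, `σ` sends each of `u`, `v` to one of the two. If both stay, they and `t` are three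
    -- fixed points of a reflection; if both go to the same one, injectivity fails; the exchange is
    -- excluded by `not_swaps_branches`.
    rcases hC.double (σ u) u v hu' hv.symm with h1 | h1 | h1
    · rcases hC.double (σ v) v u hv' hv with h2 | h2 | h2
      · exact huv (hσ.sameParam_of_fixed ht h1.symm h2.symm hut hvt)
      · exact huv h2.symm
      · exact huv (hσ.sameParam_iff.1 (h1.trans h2.symm))
    · exact huv h1
    · rcases hC.double (σ v) v u hv' hv with h2 | h2 | h2
      · exact huv (hσ.sameParam_iff.1 (h1.trans h2.symm))
      · exact huv h2.symm
      · exact hσ.not_swaps_branches hh hC huv hv.symm h1.symm h2.symm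
  have : Fintype C.crossings := hC.finite_crossings.fintype
  let f : Function.End C.crossings := fun x ↦ ⟨h x, hσ.map_mem_crossings x.2⟩
  -- The exponent is written as a prime power for the count modulo 2 of the fixed points of a map of
  -- order dividing `p ^ n`.
  have hf : f ^ 2 ^ 1 = 1 := by
    funext x
    exact Subtype.ext (hσ.map_map_crossing hC ht x.2)
  have hfixed : Function.fixedPoints f = {⟨C.toFun t, hp⟩} := by
    ext x
    constructor
    · intro hx
      exact Subtype.ext (huniq x x.2 (congrArg Subtype.val hx))
    · rintro rfl
      exact Subtype.ext (by simp only [f, hσ.map_toFun, ht])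
  have hmod := Equiv.Perm.card_fixedPoints_modEq (p := 2) (n := 1) hf
  have hcard : Fintype.card (Function.fixedPoints f) = 1 := by
    simp [hfixed]
  rw [hcard] at hmod
  rw [crossingNumber, ← Nat.card_coe_set_eq, Nat.card_eq_fintype_card]
  exact Nat.odd_iff.2 hmod

end ReversedBy

end ClosedCurve

theorem mainTheorem4 :
    (∀ C : ClosedCurve, C.IsGeneric → Even C.crossingNumber →
      ¬ ∃ h : ℂ ≃ₜ ℂ, OrientationPreserving h ∧ SendsTo h C C.reverse) ∧
    (∀ (C : ClosedCurve) (b : ℂ), C.IsGeneric → b ∈ C.support → b ∉ C.crossings →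
      Odd C.crossingNumber →
      ¬ ∃ h : ℂ ≃ₜ ℂ, OrientationPreserving h ∧ h b = b ∧ SendsTo h C C.reverse) := by
  constructor
  · rintro C hC heven ⟨h, hh, hs⟩
    obtain ⟨σ, hσ⟩ := ClosedCurve.exists_reversedBy_of_sendsTo hs
    exact Nat.not_odd_iff_even.2 heven (hσ.odd_crossingNumber hh hC)
  · rintro C _ hC ⟨t, rfl⟩ ht - ⟨h, hh, hb, hs⟩
    obtain ⟨σ, hσ⟩ := ClosedCurve.exists_reversedBy_of_sendsTo hs
    obtain ⟨n, hn⟩ := ClosedCurve.sameParam_of_notMem_crossings ht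
      (show C.toFun (σ t) = C.toFun t by rw [← hσ.map_toFun, hb])
    -- The base point is fixed only modulo 1; shifting `σ` by `n` makes `t` a genuine fixed point.
    exact (hσ.add_int n).not_fixed_of_notMem_crossings hh hC ht hn.symm
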